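/- Let $N\ge 2$, $L,\beta>0$, $k\in\mathbb Z$, $\omega_N=e^{2\pi i/N}$. Let $\Omega:\mathbb R\to SU(N)$ be smooth with $\Omega(0)=\mathbb 1$ and $\Omega(x+L)=\omega_N^k\,\Omega(x)$ for all $x$ (so that $\Omega(L)=\omega_N^k\mathbb 1$, and $\Omega$ represents the class of $k$ in $\pi_1(SU(N)/Z_N)=Z_N$; the loop is non-contractible when $N\nmid k$). A gauge field is a pair $A_\mu(x,t)$, $\mu=0,1$ (with $\partial_0=\partial_t$, $\partial_1=\partial_x$), of smooth functions on $\mathbb R^2$ with values in the traceless Hermitian $N\times N$ matrices; it satisfies the twisted boundary conditions on the torus $0\le x\le L$, $0\le t\le\beta$ if, for all $(x,t)\in\mathbb R^2$, $$A_\mu(x+L,t)=A_\mu(x,t),\qquad A_\mu(x,t+\beta)=-i\,[\partial_\mu\Omega(x)]\,\Omega^{-1}(x)+\Omega(x)A_\mu(x,t)\Omega^{-1}(x).$$ Then every gauge field $A_\mu$ satisfying these conditions can be smoothly deformed to a pure gauge with zero field density: there is a family $A_\mu^{(s)}(x,t)$, smooth in $(s,x,t)\in[0,1]\times\mathbb R^2$,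 such that for each $s\in[0,1]$ the field $A^{(s)}_\mu$ is a gauge field satisfying the same boundary conditions (with the same $\Omega$), $A^{(0)}_\mu=A_\mu$, and $$A_\mu^{(1)}=i\,U^{-1}\partial_\mu U$$ for some smooth $U:\mathbb R^2\to SU(N)$; moreover the field density $F_{\mu\nu}=\partial_\mu A_\nu-\partial_\nu A_\mu-i[A_\mu,A_\nu]$ of $A^{(1)}$ vanishes identically. -/

import Mathlib

open Complex
open scoped ContDiff

/-! Two-dimensional `SU(N)` gauge fields on a Euclidean torus with sides `L` and `β`, described on
its universal cover `ℝ²` by quasi-periodic functions.  A point is a pair `(x, t)`; the index `0`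
stands for the time direction and the index `1` for the space direction. -/

namespace TorusGauge

/-- Complex `N × N` matrices. -/
abbrev Mat (N : ℕ) : Type := Matrix (Fin N) (Fin N) ℂ

/-- The gauge group `SU(N)`. -/
abbrev SU (N : ℕ) : Type := Matrix.specialUnitaryGroup (Fin N) ℂ

/-- The root of unity `ω_N = exp(2πi/N)`. -/
noncomputable def omega (N : ℕ) : ℂ := Complex.exp (2 * (Real.pi : ℂ) * I / (N : ℂ))

/-- The coordinate vectors of `ℝ²`: `0` is the `t` direction, `1` is the `x` direction. -/
def dir (μ : Fin 2) : ℝ × ℝ := if μ = 0 then (0, 1) else (1, 0)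

/-- Smoothness (`C^∞`) of a matrix-valued function, entry by entry. -/
def Smooth {E : Type*} [NormedAddCommGroup E] [NormedSpace ℝ E] {N : ℕ} (f : E → Mat N) : Prop :=
  ∀ i j, ContDiff ℝ ∞ (fun p => f p i j)

/-- Smoothness (`C^∞`) on a set of a matrix-valued function, entry by entry. -/
def SmoothOn {E : Type*} [NormedAddCommGroup E] [NormedSpace ℝ E] {N : ℕ} (f : E → Mat N)
    (s : Set E) : Prop :=
  ∀ i j, ContDiffOn ℝ ∞ (fun p => f p i j) s

/-- The partial derivative `∂_μ f` of a matrix-valued function on `ℝ²`. -/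
noncomputable def partialD {N : ℕ} (μ : Fin 2) (f : ℝ × ℝ → Mat N) (p : ℝ × ℝ) : Mat N :=
  Matrix.of fun i j => fderiv ℝ (fun q => f q i j) p (dir μ)

/-- A pair of components `(A_0, A_1)` on `ℝ²` with matrix values. -/
abbrev Potential (N : ℕ) : Type := Fin 2 → ℝ × ℝ → Mat N

/-- A smooth `SU(N)` gauge potential: its components are smooth, Hermitian and traceless. -/
def IsGaugeField {N : ℕ} (A : Potential N) : Prop :=
  (∀ μ, Smooth (A μ)) ∧ ∀ μ p, (A μ p).IsHermitian ∧ (A μ p).trace = 0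

/-- The gauge transform `A^U_μ = -i (∂_μ U) U⁻¹ + U A_μ U⁻¹`. -/
noncomputable def gaugeTransform {N : ℕ} (U : ℝ × ℝ → SU N) (A : Potential N) : Potential N :=
  fun μ p =>
    (-I) • (partialD μ (fun q => (U q : Mat N)) p * (((U p)⁻¹ : SU N) : Mat N))
      + (U p : Mat N) * A μ p * (((U p)⁻¹ : SU N) : Mat N)

/-- The field density `F_{μν} = ∂_μ A_ν - ∂_ν A_μ - i [A_μ, A_ν]`. -/
noncomputable def fieldStrength {N : ℕ} (A : Potential N) (μ ν : Fin 2) (p : ℝ × ℝ) : Mat N :=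
  partialD μ (A ν) p - partialD ν (A μ) p - I • (A μ p * A ν p - A ν p * A μ p)

/-- A smooth twist function in the topological sector `k`: `Ω : ℝ → SU(N)` with `Ω(0) = 1` and
`Ω(x + L) = ω_N^k Ω(x)`; in particular `Ω(L) = ω_N^k`, and `Ω` represents the class `k` of
`π₁(SU(N)/Z_N) = Z_N`. -/
def IsTwist {N : ℕ} (L : ℝ) (k : ℤ) (Ω : ℝ → SU N) : Prop :=
  Smooth (fun x => (Ω x : Mat N)) ∧ Ω 0 = 1 ∧
    ∀ x, (Ω (x + L) : Mat N) = (omega N) ^ k • (Ω x : Mat N)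

/-- The twisted boundary conditions on the torus: periodicity in `x`, and periodicity in `t` up to
the time-independent gauge transformation `Ω(x)`. -/
def TwistedBC {N : ℕ} (L β : ℝ) (Ω : ℝ → SU N) (A : Potential N) : Prop :=
  ∀ μ x t, A μ (x + L, t) = A μ (x, t) ∧
    A μ (x, t + β) = gaugeTransform (fun q => Ω q.1) A μ (x, t)

/-- `A` is a pure gauge: `A_μ = i U⁻¹ ∂_μ U` for a smooth `U : ℝ² → SU(N)`. -/
def IsPureGauge {N : ℕ} (A : Potential N) : Prop :=
  ∃ U : ℝ × ℝ → SU N, Smooth (fun p => (U p : Mat N)) ∧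
    ∀ μ p, A μ p = I • ((((U p)⁻¹ : SU N) : Mat N) * partialD μ (fun q => (U q : Mat N)) p)

/-- `𝒜` is a smooth deformation, with parameter `s ∈ [0, 1]`, from `A` to `A'` through gauge fields
that all satisfy the twisted boundary conditions given by `Ω`. -/
def IsSmoothDeformation {N : ℕ} (L β : ℝ) (Ω : ℝ → SU N) (A A' : Potential N)
    (𝒜 : ℝ → Potential N) : Prop :=
  (∀ μ, SmoothOn (fun z : ℝ × (ℝ × ℝ) => 𝒜 z.1 μ z.2) (Set.Icc 0 1 ×ˢ Set.univ)) ∧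
    (∀ s ∈ Set.Icc (0 : ℝ) 1, IsGaugeField (𝒜 s) ∧ TwistedBC L β Ω (𝒜 s)) ∧
    𝒜 0 = A ∧ 𝒜 1 = A'

end TorusGauge

/-! Potentials satisfying the twisted boundary conditions form an affine space, because the
conditions are affine in `A`; a straight line from `A` to any flat gauge field `A'` with the same
boundary conditions is therefore a deformation as required (`exists_isSmoothDeformation`), and
everything rests on the existence of one flat `A'`.

The pure gauge `i U⁻¹ ∂U` satisfies the boundary conditions as soon as `U (x + L, t) = a U (x, t)`
and `U (x, t + β) = b U (x, t) Ω(x)⁻¹` for constants `a, b ∈ SU(N)` (`twistedBC_pureGauge`).  Going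
around the torus both ways forces `a⁻¹ b a = ω_N^k b`, which the clock and shift matrices solve
(`exists_shift`).  The clock matrix lies on a one-parameter group `α` with `α(L) = a`.  Writing
`U = α W`, one needs `W` periodic in `x` with `W (x, t + β) = T(x) W (x, t) Ω(x)⁻¹`, where
`T = α⁻¹ b α`.  Since `T` and `Ω` pick up the same central factor under `x ↦ x + L`, the product
`T Ω⁻¹` is a periodic loop in `SU(N)`, and a smooth null-homotopy of it provides `W` on the strip
`0 ≤ t ≤ β`, hence everywhere (`exists_quasiPeriodic`).

So the topological input is the simple connectedness of `SU(N)` (`nullHomotopic_of_periodic`).  It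
is proved by making a loop `g` fix one basis vector after another.  The curve `g e_a` in the unit
sphere misses a unit vector `w`, by a dimension count (`exists_unit_notMem_range`).  On the sphere
minus `w` there is an explicit smooth map to `SU(N)`, a product of two complex reflections written
in stereographic coordinates, whose value at `v` sends `v` to `w` (`rot`).  Scaling these
coordinates contracts the resulting loop in `SU(N)`, and multiplying `g` by it gives a loop fixing
`e_a` (`exists_nullHomotopic_mul_fixes`). -/

namespace TorusGauge

open scoped Matrix

/-! ### Smooth matrix-valued maps -/

section Calculus

variable {E : Type*} [NormedAddCommGroup E] [NormedSpace ℝ E] {N : ℕ}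

lemma smooth_const (M : Mat N) : Smooth (fun _ : E => M) := fun _ _ => contDiff_const

lemma Smooth.add {f g : E → Mat N} (hf : Smooth f) (hg : Smooth g) :
    Smooth (fun p => f p + g p) := fun i j => (hf i j).add (hg i j)

lemma Smooth.sub {f g : E → Mat N} (hf : Smooth f) (hg : Smooth g) :
    Smooth (fun p => f p - g p) := fun i j => (hf i j).sub (hg i j)

lemma Smooth.mul {f g : E → Mat N} (hf : Smooth f) (hg : Smooth g) :
    Smooth (fun p => f p * g p) := fun i j => by
  simp only [Matrix.mul_apply]
  exact ContDiff.sum fun l _ => (hf i l).mul (hg l j)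

lemma Smooth.smul {c : E → ℂ} {f : E → Mat N} (hc : ContDiff ℝ ∞ c) (hf : Smooth f) :
    Smooth (fun p => c p • f p) := fun i j => hc.mul (hf i j)

lemma Smooth.conjTranspose {f : E → Mat N} (hf : Smooth f) :
    Smooth (fun p => (f p).conjTranspose) := fun i j =>
  (conjCLE : ℂ →L[ℝ] ℂ).contDiff.comp (hf j i)

lemma Smooth.comp {F : Type*} [NormedAddCommGroup F] [NormedSpace ℝ F] {f : E → Mat N}
    (hf : Smooth f) {φ : F → E} (hφ : ContDiff ℝ ∞ φ) : Smooth (fun p => f (φ p)) :=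
  fun i j => (hf i j).comp hφ

lemma coe_inv (U : SU N) : ((U⁻¹ : SU N) : Mat N) = (U : Mat N).conjTranspose := rfl

@[simp] lemma coe_mul_inv (U : SU N) : (U : Mat N) * ((U⁻¹ : SU N) : Mat N) = 1 := by
  rw [← Submonoid.coe_mul, mul_inv_cancel, Submonoid.coe_one]

@[simp] lemma coe_inv_mul (U : SU N) : ((U⁻¹ : SU N) : Mat N) * (U : Mat N) = 1 := by
  rw [← Submonoid.coe_mul, inv_mul_cancel, Submonoid.coe_one]

lemma Smooth.coe_mul {f g : E → SU N} (hf : Smooth fun p => (f p : Mat N))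
    (hg : Smooth fun p => (g p : Mat N)) : Smooth fun p => ((f p * g p : SU N) : Mat N) := hf.mul hg

lemma Smooth.coe_inv {f : E → SU N} (hf : Smooth fun p => (f p : Mat N)) :
    Smooth fun p => (((f p)⁻¹ : SU N) : Mat N) := hf.conjTranspose

lemma Smooth.coe_zpow {f : E → SU N} (hf : Smooth (fun p => (f p : Mat N))) (n : ℤ) :
    Smooth (fun p => (f p ^ n : SU N).1) := by
  have hpow : ∀ m : ℕ, Smooth (fun p => (f p ^ m : SU N).1) := fun m => by
    induction m with
    | zero => simpa using smooth_const (1 : Mat N)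
    | succ m ih => simpa [pow_succ] using ih.mul hf
  cases n with
  | ofNat m => simpa using hpow m
  | negSucc m => simpa only [zpow_negSucc] using (hpow (m + 1)).coe_inv

end Calculus

/-! ### Partial derivatives -/

section PartialDerivatives

variable {N : ℕ} {f g : ℝ × ℝ → Mat N}

lemma Smooth.differentiable (hf : Smooth f) (i j : Fin N) :
    Differentiable ℝ (fun p => f p i j) := (hf i j).differentiable (by simp)

lemma partialD_const (μ : Fin 2) (M : Mat N) (p : ℝ × ℝ) : partialD μ (fun _ => M) p = 0 := by
  ext i j; simp [partialD]

lemma partialD_mul (hf : Smooth f) (hg : Smooth g) (μ : Fin 2) (p : ℝ × ℝ) :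
    partialD μ (fun q => f q * g q) p = partialD μ f p * g p + f p * partialD μ g p := by
  ext i j
  simp only [partialD, Matrix.of_apply, Matrix.add_apply, Matrix.mul_apply]
  rw [fderiv_fun_sum fun l _ => (hf.differentiable i l p).fun_mul (hg.differentiable l j p),
    _root_.sum_apply, ← Finset.sum_add_distrib]
  refine Finset.sum_congr rfl fun l _ => ?_
  rw [fderiv_fun_mul (hf.differentiable i l p) (hg.differentiable l j p)]
  simp only [_root_.add_apply, _root_.smul_apply, smul_eq_mul]
  ring

lemma partialD_smul (hf : Smooth f) (c : ℂ) (μ : Fin 2) (p : ℝ × ℝ) :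
    partialD μ (fun q => c • f q) p = c • partialD μ f p := by
  ext i j
  simp only [partialD, Matrix.of_apply, Matrix.smul_apply, smul_eq_mul]
  rw [fderiv_const_mul (hf.differentiable i j p)]
  rfl

lemma partialD_conjTranspose (hf : Smooth f) (μ : Fin 2) (p : ℝ × ℝ) :
    partialD μ (fun q => (f q).conjTranspose) p = (partialD μ f p).conjTranspose := by
  ext i j
  simp only [partialD, Matrix.of_apply, Matrix.conjTranspose_apply]
  have h := ((conjCLE : ℂ →L[ℝ] ℂ).hasFDerivAt.comp p (hf.differentiable j i p).hasFDerivAt).fderiv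
  exact congrArg (fun T => T (dir μ)) h

lemma partialD_comp_add_right (v : ℝ × ℝ) (μ : Fin 2) (p : ℝ × ℝ) :
    partialD μ (fun q => f (q + v)) p = partialD μ f (p + v) := by
  ext i j
  simp only [partialD, Matrix.of_apply]
  rw [fderiv_comp_add_right (f := fun q => f q i j) v]

lemma Smooth.partialD (hf : Smooth f) (μ : Fin 2) : Smooth (partialD μ f) := fun i j =>
  ((hf i j).fderiv_right (m := ∞) (by simp)).clm_apply contDiff_const

lemma partialD_comm (hf : Smooth f) (μ ν : Fin 2) (p : ℝ × ℝ) :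
    TorusGauge.partialD μ (TorusGauge.partialD ν f) p =
      TorusGauge.partialD ν (TorusGauge.partialD μ f) p := by
  ext i j
  have key : ∀ a b : Fin 2, TorusGauge.partialD a (TorusGauge.partialD b f) p i j =
      fderiv ℝ (fderiv ℝ fun q => f q i j) p (dir a) (dir b) := fun a b => by
    have hd : DifferentiableAt ℝ (fderiv ℝ fun q => f q i j) p :=
      ((hf i j).fderiv_right (m := ∞) (by simp)).differentiable (by simp) p
    simp only [TorusGauge.partialD, Matrix.of_apply]
    rw [fderiv_clm_apply hd (differentiableAt_const _)]
    simp
  rw [key, key]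
  exact ((hf i j).contDiffAt.isSymmSndFDerivAt
    (by simpa using WithTop.coe_le_coe.2 (le_top : (2 : ℕ∞) ≤ ⊤))).eq _ _

end PartialDerivatives

/-! ### Logarithmic derivatives are traceless -/

section Determinant

variable {N : ℕ}

/-- The derivative of the determinant at the identity is the trace. -/
lemma hasDerivAt_det_of_eq_one {M : ℝ → Mat N} {M' : Mat N} (h0 : M 0 = 1)
    (hM : ∀ i j, HasDerivAt (fun t => M t i j) (M' i j) 0) :
    HasDerivAt (fun t => (M t).det) M'.trace 0 := by
  let d : (Fin N → Fin N → ℂ) → ℂ := fun X => (Matrix.of X).det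
  have hd : Differentiable ℝ d := by
    simp only [d, Matrix.det_apply, Matrix.of_apply]
    fun_prop
  let e : Mat N → Fin N → Fin N → ℂ := fun X i j => X i j
  -- the directional derivative is read off from the polynomial `det (1 + t X)`
  have hdir : fderiv ℝ d (e 1) (e M') = M'.trace := by
    have hline : HasDerivAt (fun t : ℝ => e 1 + t • e M') (e M') 0 := by
      simpa using ((hasDerivAt_id (0 : ℝ)).smul_const (e M')).const_add (e 1)
    have h1 : HasDerivAt (fun t : ℝ => d (e 1 + t • e M')) (fderiv ℝ d (e 1) (e M')) 0 := by
      refine HasFDerivAt.comp_hasDerivAt (0 : ℝ) ?_ hline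
      rw [zero_smul, add_zero]
      exact (hd (e 1)).hasFDerivAt
    have h2 : HasDerivAt (fun t : ℝ => d (e 1 + t • e M')) M'.trace 0 := by
      have hpoly : ∀ t : ℝ, d (e 1 + t • e M') = 1 + M'.trace * t +
          ((1 + (Polynomial.X : Polynomial ℂ) • M'.map Polynomial.C).det.divX.divX).eval (t : ℂ)
            * (t : ℂ) ^ 2 := fun t => by
        have h := Matrix.det_one_add_smul (t : ℂ) M'
        rw [← h]
        rfl
      have ht : HasDerivAt (fun t : ℝ => (t : ℂ)) 1 0 := ofRealCLM.hasDerivAt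
      have hP := (((1 + (Polynomial.X : Polynomial ℂ) •
        M'.map Polynomial.C).det.divX.divX).hasDerivAt ((0 : ℝ) : ℂ)).comp_ofReal
      have h := ((ht.const_mul M'.trace).const_add 1).fun_add (hP.fun_mul (ht.fun_pow 2))
      rw [funext hpoly]
      simpa using h
    exact h1.unique h2
  have hc : HasDerivAt (fun t => e (M t)) (e M') 0 :=
    hasDerivAt_pi.2 fun i => hasDerivAt_pi.2 fun j => hM i j
  rw [← hdir]
  refine HasFDerivAt.comp_hasDerivAt (0 : ℝ) ?_ hc
  rw [h0]
  exact (hd (e 1)).hasFDerivAt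

/-- The components of the logarithmic derivative of an `SU(N)`-valued map are traceless. -/
lemma trace_inv_mul_partialD {U : ℝ × ℝ → SU N} (hU : Smooth fun p => (U p : Mat N)) (μ : Fin 2)
    (p : ℝ × ℝ) :
    (((U p)⁻¹ : SU N).1 * partialD μ (fun q => (U q : Mat N)) p).trace = 0 := by
  have hline : HasDerivAt (fun t : ℝ => p + t • dir μ) (dir μ) 0 := by
    simpa using ((hasDerivAt_id (0 : ℝ)).smul_const (dir μ)).const_add p
  have h := hasDerivAt_det_of_eq_one
    (M := fun t : ℝ => ((U p)⁻¹ : SU N).1 * (U (p + t • dir μ) : Mat N))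
    (M' := ((U p)⁻¹ : SU N).1 * partialD μ (fun q => (U q : Mat N)) p) (by simp) fun i j => by
      simp only [Matrix.mul_apply]
      refine HasDerivAt.fun_sum fun l _ => HasDerivAt.const_mul _ ?_
      have hd : HasFDerivAt (fun q => (U q : Mat N) l j) (fderiv ℝ (fun q => (U q : Mat N) l j) p)
        (p + (0 : ℝ) • dir μ) := by simpa using (hU.differentiable l j p).hasFDerivAt
      exact hd.comp_hasDerivAt (0 : ℝ) hline
  have hone : (fun t : ℝ => (((U p)⁻¹ : SU N).1 * (U (p + t • dir μ) : Mat N)).det) =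
      fun _ => 1 := by
    funext t
    exact (Matrix.mem_specialUnitaryGroup_iff.1 ((U p)⁻¹ * U (p + t • dir μ)).2).2
  rw [hone] at h
  exact h.unique (hasDerivAt_const _ _)

end Determinant

/-! ### Pure gauges -/

section PureGauge

variable {N : ℕ}

/-- The pure gauge potential `i U⁻¹ ∂_μ U`. -/
noncomputable def pureGauge (U : ℝ × ℝ → SU N) : Potential N :=
  fun μ p => I • (((U p)⁻¹ : SU N).1 * partialD μ (fun q => (U q : Mat N)) p)

lemma isPureGauge_pureGauge {U : ℝ × ℝ → SU N} (hU : Smooth fun p => (U p : Mat N)) :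
    IsPureGauge (pureGauge U) := ⟨U, hU, fun _ _ => rfl⟩

/-- Differentiating `U⁻¹ U = 1`. -/
lemma partialD_inv {U : ℝ × ℝ → SU N} (hU : Smooth fun p => (U p : Mat N)) (μ : Fin 2)
    (p : ℝ × ℝ) :
    partialD μ (fun q => ((U q)⁻¹ : SU N).1) p =
      -(((U p)⁻¹ : SU N).1 * partialD μ (fun q => (U q : Mat N)) p * ((U p)⁻¹ : SU N).1) := by
  have h := partialD_mul hU.coe_inv hU μ p
  simp only [coe_inv_mul, partialD_const] at h
  have h2 := congrArg (fun M => M * ((U p)⁻¹ : SU N).1) h.symm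
  simp only [add_mul, zero_mul, Matrix.mul_assoc, coe_mul_inv, Matrix.mul_one] at h2
  rw [Matrix.mul_assoc]
  exact eq_neg_of_add_eq_zero_left h2

lemma isGaugeField_pureGauge {U : ℝ × ℝ → SU N} (hU : Smooth fun p => (U p : Mat N)) :
    IsGaugeField (pureGauge U) := by
  refine ⟨fun μ => Smooth.smul contDiff_const (hU.coe_inv.mul (hU.partialD μ)), fun μ p => ⟨?_, ?_⟩⟩
  · have h : (partialD μ (fun q => (U q : Mat N)) p).conjTranspose =
        partialD μ (fun q => ((U q)⁻¹ : SU N).1) p := (partialD_conjTranspose hU μ p).symm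
    have hinv : (((U p)⁻¹ : SU N).1).conjTranspose = (U p : Mat N) :=
      Matrix.conjTranspose_conjTranspose _
    rw [pureGauge, Matrix.IsHermitian, Matrix.conjTranspose_smul, Matrix.conjTranspose_mul, h,
      hinv, partialD_inv hU]
    simp [Matrix.mul_assoc]
  · rw [pureGauge, Matrix.trace_smul, trace_inv_mul_partialD hU, smul_zero]

lemma fieldStrength_pureGauge {U : ℝ × ℝ → SU N} (hU : Smooth fun p => (U p : Mat N))
    (μ ν : Fin 2) (p : ℝ × ℝ) : fieldStrength (pureGauge U) μ ν p = 0 := by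
  have key : ∀ a b, partialD a (pureGauge U b) p =
      I • (-(((U p)⁻¹ : SU N).1 * partialD a (fun q => (U q : Mat N)) p * ((U p)⁻¹ : SU N).1) *
          partialD b (fun q => (U q : Mat N)) p +
        ((U p)⁻¹ : SU N).1 * partialD a (partialD b fun q => (U q : Mat N)) p) := fun a b => by
    unfold pureGauge
    rw [partialD_smul (hU.coe_inv.mul (hU.partialD b)), partialD_mul hU.coe_inv (hU.partialD b),
      partialD_inv hU]
  -- with `B_μ = U⁻¹ ∂_μ U` and symmetry of second derivatives, `∂_μ A_ν - ∂_ν A_μ = -i [B_μ, B_ν]`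
  rw [fieldStrength, key, key, partialD_comm hU ν μ]
  simp only [pureGauge, smul_mul_assoc, mul_smul_comm, smul_smul, I_mul_I, Matrix.mul_assoc,
    smul_add, neg_mul, smul_neg, neg_smul, one_smul, sub_neg_eq_add]
  abel

/-- A gauge function which is quasi-periodic, up to constants on the left and `Ω⁻¹` on the right,
gives a pure gauge potential with the twisted boundary conditions. -/
lemma twistedBC_pureGauge {L β : ℝ} {Ω : ℝ → SU N} (hΩ : Smooth fun x => (Ω x : Mat N))
    {U : ℝ × ℝ → SU N} (hU : Smooth fun p => (U p : Mat N)) (a b : SU N)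
    (hx : ∀ x t, U (x + L, t) = a * U (x, t))
    (ht : ∀ x t, U (x, t + β) = b * U (x, t) * (Ω x)⁻¹) :
    TwistedBC L β Ω (pureGauge U) := by
  intro μ x t
  constructor
  · have h : (fun q : ℝ × ℝ => (U (q + (L, 0)) : Mat N)) =
        fun q => (a : Mat N) * (U q : Mat N) := by
      funext ⟨x, t⟩
      simp [hx]
    have hd := partialD_comp_add_right (f := fun q => (U q : Mat N)) (L, 0) μ (x, t)
    rw [h, partialD_mul (smooth_const _) hU, partialD_const, zero_mul, zero_add] at hd
    simp only [Prod.mk_add_mk, add_zero] at hd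
    simp only [pureGauge]
    rw [← hd, hx, mul_inv_rev, Submonoid.coe_mul, Matrix.mul_assoc,
      ← Matrix.mul_assoc _ (a : Mat N), coe_inv_mul, Matrix.one_mul]
  · have hΩ2 : Smooth fun q : ℝ × ℝ => (Ω q.1 : Mat N) := hΩ.comp contDiff_fst
    have h : (fun q : ℝ × ℝ => (U (q + (0, β)) : Mat N)) =
        fun q => (b : Mat N) * ((U q : Mat N) * ((Ω q.1)⁻¹ : SU N).1) := by
      funext ⟨x, t⟩
      simp [ht, Matrix.mul_assoc]
    have hd := partialD_comp_add_right (f := fun q => (U q : Mat N)) (0, β) μ (x, t)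
    rw [h, partialD_mul (smooth_const _) (hU.mul hΩ2.coe_inv), partialD_const, zero_mul, zero_add,
      partialD_mul hU hΩ2.coe_inv, partialD_inv hΩ2] at hd
    simp only [Prod.mk_add_mk, add_zero] at hd
    have hinv : ((U (x, t + β))⁻¹ : SU N) = Ω x * (U (x, t))⁻¹ * b⁻¹ := by
      rw [ht]; group
    simp only [pureGauge, gaugeTransform]
    rw [← hd, hinv, Submonoid.coe_mul, Submonoid.coe_mul]
    have cancel : ∀ (V : SU N) (M : Mat N), ((V⁻¹ : SU N) : Mat N) * ((V : Mat N) * M) = M :=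
      fun V M => by rw [← Matrix.mul_assoc, coe_inv_mul, Matrix.one_mul]
    have cancel' : ∀ (V : SU N) (M : Mat N), (V : Mat N) * (((V⁻¹ : SU N) : Mat N) * M) = M :=
      fun V M => by rw [← Matrix.mul_assoc, coe_mul_inv, Matrix.one_mul]
    simp only [Matrix.mul_assoc, cancel, cancel', Matrix.mul_add, Matrix.mul_neg, smul_add,
      smul_neg, neg_smul, Matrix.mul_smul, Matrix.smul_mul, Matrix.mul_smul]
    abel

end PureGauge

/-! ### Straight-line deformations -/

section Interpolation

variable {N : ℕ}

/-- The boundary conditions are affine in the potential, so two gauge fields satisfying them are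
joined by a straight line. -/
lemma exists_isSmoothDeformation {L β : ℝ} {Ω : ℝ → SU N} {A A' : Potential N}
    (hA : IsGaugeField A) (hA' : IsGaugeField A') (hbc : TwistedBC L β Ω A)
    (hbc' : TwistedBC L β Ω A') : ∃ 𝒜, IsSmoothDeformation L β Ω A A' 𝒜 := by
  refine ⟨fun s μ p => ((1 - s : ℝ) : ℂ) • A μ p + (s : ℂ) • A' μ p, fun μ i j => ?_,
    fun s _ => ⟨⟨fun μ => ?_, fun μ p => ⟨?_, ?_⟩⟩, fun μ x t => ⟨?_, ?_⟩⟩, ?_, ?_⟩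
  · have h1 : Smooth fun z : ℝ × (ℝ × ℝ) => A μ z.2 := (hA.1 μ).comp contDiff_snd
    have h2 : Smooth fun z : ℝ × (ℝ × ℝ) => A' μ z.2 := (hA'.1 μ).comp contDiff_snd
    exact ((Smooth.smul (ofRealCLM.contDiff.comp (contDiff_const.sub contDiff_fst)) h1).add
      (Smooth.smul (ofRealCLM.contDiff.comp contDiff_fst) h2) i j).contDiffOn
  · exact (Smooth.smul contDiff_const (hA.1 μ)).add (Smooth.smul contDiff_const (hA'.1 μ))
  · rw [Matrix.IsHermitian, Matrix.conjTranspose_add, Matrix.conjTranspose_smul,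
      Matrix.conjTranspose_smul, (hA.2 μ p).1, (hA'.2 μ p).1]
    simp only [Complex.star_def, conj_ofReal]
  · rw [Matrix.trace_add, Matrix.trace_smul, Matrix.trace_smul, (hA.2 μ p).2, (hA'.2 μ p).2]
    simp
  · simp only [(hbc μ x t).1, (hbc' μ x t).1]
  · simp only [(hbc μ x t).2, (hbc' μ x t).2, gaugeTransform, Matrix.mul_add, Matrix.add_mul,
      smul_add, Matrix.mul_smul, Matrix.smul_mul]
    push_cast
    module
  · funext μ p; simp
  · funext μ p; simp

end Interpolation

/-! ### Complex reflections -/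

section Reflections

variable {N : ℕ}

/-- The squared Euclidean norm `∑ |q_i|²`, as a real number. -/
def sqNorm (q : Fin N → ℂ) : ℝ := ∑ i, normSq (q i)

lemma star_dotProduct_self (q : Fin N → ℂ) : star q ⬝ᵥ q = (sqNorm q : ℂ) := by
  simp [dotProduct, sqNorm, normSq_eq_conj_mul_self]

lemma sqNorm_pos {q : Fin N → ℂ} (hq : q ≠ 0) : 0 < sqNorm q := by
  obtain ⟨i, hi⟩ := Function.ne_iff.1 hq
  exact Finset.sum_pos' (fun j _ => normSq_nonneg _) ⟨i, Finset.mem_univ _, normSq_pos.2 hi⟩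

/-- The complex reflection `1 - (|q|²/2 + iτ)⁻¹ q q*`: the identity on `q^⊥` and, by the choice of
the scalar, a phase on `q`. -/
noncomputable def refl (q : Fin N → ℂ) (τ : ℝ) : Mat N :=
  1 - ((sqNorm q / 2 : ℂ) + τ * I)⁻¹ • Matrix.vecMulVec q (star q)

lemma refl_denom_ne_zero {q : Fin N → ℂ} (hq : q ≠ 0) (τ : ℝ) :
    ((sqNorm q / 2 : ℂ) + τ * I) ≠ 0 := fun h => by
  have h2 := congrArg Complex.re h
  simp at h2
  exact (sqNorm_pos hq).ne' h2

lemma refl_mulVec (q v : Fin N → ℂ) (τ : ℝ) :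
    refl q τ *ᵥ v = v - (((sqNorm q / 2 : ℂ) + τ * I)⁻¹ * (star q ⬝ᵥ v)) • q := by
  rw [refl, Matrix.sub_mulVec, Matrix.one_mulVec, Matrix.smul_mulVec, Matrix.vecMulVec_mulVec]
  congr 1
  ext i
  simp
  ring

lemma refl_mulVec_single {q : Fin N → ℂ} {i : Fin N} (hi : q i = 0) (τ : ℝ) :
    refl q τ *ᵥ Pi.single i 1 = Pi.single i 1 := by
  rw [refl_mulVec]
  simp [hi]

lemma refl_mem_unitaryGroup {q : Fin N → ℂ} (hq : q ≠ 0) (τ : ℝ) :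
    refl q τ ∈ Matrix.unitaryGroup (Fin N) ℂ := by
  have h1 := refl_denom_ne_zero hq τ
  have h2 : ((sqNorm q / 2 : ℂ) - τ * I) ≠ 0 := by
    simpa [sub_eq_add_neg] using refl_denom_ne_zero hq (-τ)
  rw [Matrix.mem_unitaryGroup_iff, Matrix.star_eq_conjTranspose, refl,
    Matrix.conjTranspose_sub, Matrix.conjTranspose_one, Matrix.conjTranspose_smul,
    Matrix.conjTranspose_vecMulVec, star_star]
  have hc : star (((sqNorm q / 2 : ℂ) + τ * I)⁻¹) = ((sqNorm q / 2 : ℂ) - τ * I)⁻¹ := by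
    simp [sub_eq_add_neg]
  have hP : Matrix.vecMulVec q (star q) * Matrix.vecMulVec q (star q) =
      (sqNorm q : ℂ) • Matrix.vecMulVec q (star q) := by
    rw [Matrix.vecMulVec_mul_vecMulVec, star_dotProduct_self, Matrix.vecMulVec_smul]
  rw [hc, sub_mul, one_mul, mul_sub, mul_one, smul_mul_smul_comm, hP]
  have hs : ((sqNorm q / 2 : ℂ) + τ * I)⁻¹ * ((sqNorm q / 2 : ℂ) - τ * I)⁻¹ * sqNorm q =
      ((sqNorm q / 2 : ℂ) + τ * I)⁻¹ + ((sqNorm q / 2 : ℂ) - τ * I)⁻¹ := by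
    have hsum : (sqNorm q : ℂ) = ((sqNorm q / 2 : ℂ) + τ * I) + ((sqNorm q / 2 : ℂ) - τ * I) := by
      ring
    rw [inv_add_inv h1 h2, ← hsum, ← mul_inv, ← div_eq_inv_mul]
  rw [smul_smul, hs]
  module

lemma det_refl {q : Fin N → ℂ} (hq : q ≠ 0) (τ : ℝ) :
    (refl q τ).det = (-(sqNorm q / 2 : ℂ) + τ * I) / ((sqNorm q / 2 : ℂ) + τ * I) := by
  have h1 := refl_denom_ne_zero hq τ
  have h : refl q τ = 1 + Matrix.replicateCol Unit (-((sqNorm q / 2 : ℂ) + τ * I)⁻¹ • q) *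
      Matrix.replicateRow Unit (star q) := by
    rw [← Matrix.vecMulVec_eq, Matrix.smul_vecMulVec, neg_smul, ← sub_eq_add_neg, refl]
  rw [h, Matrix.det_one_add_replicateCol_mul_replicateRow, dotProduct_smul, star_dotProduct_self,
    smul_eq_mul, eq_div_iff h1, add_mul, one_mul, mul_right_comm, neg_mul, inv_mul_cancel₀ h1]
  ring

lemma smooth_refl {E : Type*} [NormedAddCommGroup E] [NormedSpace ℝ E] {q : E → Fin N → ℂ}
    {τ : E → ℝ} (hq : ∀ i, ContDiff ℝ ∞ fun p => q p i) (hτ : ContDiff ℝ ∞ τ)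
    (h0 : ∀ p, q p ≠ 0) : Smooth fun p => refl (q p) (τ p) := by
  have hconj : ∀ i, ContDiff ℝ ∞ fun p => star (q p i) := fun i =>
    (conjCLE : ℂ →L[ℝ] ℂ).contDiff.comp (hq i)
  have hn : ContDiff ℝ ∞ fun p => (sqNorm (q p) : ℂ) := by
    simp only [← star_dotProduct_self, dotProduct]
    exact ContDiff.sum fun i _ => (hconj i).mul (hq i)
  have hd : ContDiff ℝ ∞ fun p => ((sqNorm (q p) / 2 : ℂ) + τ p * I) :=
    (hn.div_const 2).add ((ofRealCLM.contDiff.comp hτ).mul contDiff_const)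
  exact (smooth_const 1).sub (Smooth.smul (hd.inv fun p => refl_denom_ne_zero (h0 p) _)
    fun i j => (hq i).mul (hconj j))

end Reflections

/-! ### Moving a unit vector to a given one -/

section Rotations

variable {N : ℕ}

/-- Stereographic coordinates from the pole `w` of the unit sphere of `ℂ^N`, scaled by `s`: the
component orthogonal to `w`, shifted by `-w`.  With `z = ⟨w, v⟩`, it is `(v - w) / (1 - z)` at
`s = 1` and `-w` at `s = 0`. -/
noncomputable def axis (w : Fin N → ℂ) (s : ℝ) (v : Fin N → ℂ) : Fin N → ℂ :=
  -w + ((s : ℂ) * (1 - star w ⬝ᵥ v)⁻¹) • (v - (star w ⬝ᵥ v) • w)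

/-- The remaining real stereographic coordinate, scaled by `s`. -/
noncomputable def height (w : Fin N → ℂ) (s : ℝ) (v : Fin N → ℂ) : ℝ :=
  s * (star (1 - star w ⬝ᵥ v))⁻¹.im

lemma axis_ne_zero {w : Fin N → ℂ} (hw : sqNorm w = 1) (s : ℝ) (v : Fin N → ℂ) :
    axis w s v ≠ 0 := fun h => by
  have h2 := congrArg (fun q => star w ⬝ᵥ q) h
  simp [axis, dotProduct_add, dotProduct_smul, dotProduct_sub, star_dotProduct_self, hw] at h2

/-- A path in `SU(N)` attached to a vector `v`: the reflection with stereographic data of `v`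
times a reflection along `f` correcting the determinant.  For unit vectors `v ≠ w` and `f ⊥ w`, it
runs from an element independent of `v` at `s = 0` to an element which maps `v` to `w` at
`s = 1`. -/
noncomputable def rot {w f : Fin N → ℂ} (hw : sqNorm w = 1) (hf : sqNorm f = 1) (s : ℝ)
    (v : Fin N → ℂ) : SU N :=
  ⟨refl f (-(height w s v / sqNorm (axis w s v))) * refl (axis w s v) (height w s v), by
    have hf0 : f ≠ 0 := fun h => by simp [h, sqNorm] at hf
    have hq := axis_ne_zero hw s v
    refine Matrix.mem_specialUnitaryGroup_iff.2
      ⟨mul_mem (refl_mem_unitaryGroup hf0 _) (refl_mem_unitaryGroup hq _), ?_⟩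
    rw [Matrix.det_mul, det_refl hf0, det_refl hq, hf]
    have hn : (sqNorm (axis w s v) : ℂ) ≠ 0 := ofReal_ne_zero.2 (sqNorm_pos hq).ne'
    have h1 := refl_denom_ne_zero hq (height w s v)
    have h2 := refl_denom_ne_zero hq (-height w s v)
    generalize sqNorm (axis w s v) = n at *
    generalize height w s v = τ at *
    -- the two determinants depend on `τ / |q|²` only, and opposite values give inverse phases
    have h3 : ((1 : ℝ) / 2 : ℂ) + ((-(τ / n) : ℝ) : ℂ) * I =
        (n / 2 + ((-τ : ℝ) : ℂ) * I) / n := by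
      push_cast
      field_simp
    rw [h3, div_mul_div_comm, div_eq_one_iff_eq (mul_ne_zero (div_ne_zero h2 hn) h1)]
    push_cast
    field_simp
    ring⟩

lemma rot_zero {w f : Fin N → ℂ} (hw : sqNorm w = 1) (hf : sqNorm f = 1) (v v' : Fin N → ℂ) :
    rot hw hf 0 v = rot hw hf 0 v' := by
  simp [rot, axis, height]

lemma rot_mulVec_single {w f : Fin N → ℂ} (hw : sqNorm w = 1) (hf : sqNorm f = 1) (s : ℝ)
    {v : Fin N → ℂ} {i : Fin N} (hwi : w i = 0) (hfi : f i = 0) (hvi : v i = 0) :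
    (rot hw hf s v : Mat N) *ᵥ Pi.single i 1 = Pi.single i 1 := by
  rw [rot, ← Matrix.mulVec_mulVec, refl_mulVec_single, refl_mulVec_single hfi]
  simp [axis, hwi, hvi]

lemma dotProduct_ne_one {v w : Fin N → ℂ} (hv : sqNorm v = 1) (hw : sqNorm w = 1) (h : v ≠ w) :
    star w ⬝ᵥ v ≠ 1 := fun h1 => by
  have h2 : star v ⬝ᵥ w = 1 := by rw [Matrix.star_dotProduct, h1, star_one]
  have h3 : star (v - w) ⬝ᵥ (v - w) = 0 := by
    simp [sub_dotProduct, dotProduct_sub, h1, h2, star_dotProduct_self, hv, hw]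
  rw [star_dotProduct_self, ofReal_eq_zero] at h3
  exact (sqNorm_pos (sub_ne_zero.2 h)).ne' h3

lemma rot_one_mulVec {v w f : Fin N → ℂ} (hw : sqNorm w = 1) (hf : sqNorm f = 1)
    (hfw : star f ⬝ᵥ w = 0) (hv : sqNorm v = 1) (hvw : v ≠ w) :
    (rot hw hf 1 v : Mat N) *ᵥ v = w := by
  have hz := dotProduct_ne_one hv hw hvw
  have hvz := Matrix.star_dotProduct v w
  simp only [rot, height]
  rw [← Matrix.mulVec_mulVec]
  obtain ⟨z, hzdef⟩ : ∃ z, z = star w ⬝ᵥ v := ⟨_, rfl⟩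
  have hz1 : 1 - z ≠ 0 := sub_ne_zero.2 (by rw [hzdef]; exact hz.symm)
  have hz2 : star (1 - z) ≠ 0 := star_ne_zero.2 hz1
  have haxis : axis w 1 v = (1 - z)⁻¹ • (v - w) := by
    rw [axis, ← hzdef, ofReal_one, one_mul]
    ext i
    simp only [Pi.add_apply, Pi.neg_apply, Pi.smul_apply, Pi.sub_apply, smul_eq_mul]
    field_simp
    ring
  have hn : (sqNorm (axis w 1 v) : ℂ) = (1 - z)⁻¹ + (star (1 - z))⁻¹ := by
    rw [← star_dotProduct_self, haxis]
    simp only [star_smul, star_sub, smul_dotProduct, dotProduct_smul, sub_dotProduct,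
      dotProduct_sub, smul_eq_mul, star_dotProduct_self, hv, hw, hvz, ← hzdef, star_inv₀, star_one]
    rw [star_sub, star_one] at hz2
    push_cast
    field_simp
    ring
  have hden : ((sqNorm (axis w 1 v) / 2 : ℂ) + ((1 * (star (1 - z))⁻¹.im : ℝ) : ℂ) * I) =
      (star (1 - z))⁻¹ := by
    have hstar : (1 - z)⁻¹ = star ((star (1 - z))⁻¹) := by rw [star_inv₀, star_star]
    rw [hn, hstar]
    generalize (star (1 - z))⁻¹ = y
    apply Complex.ext <;> simp
  have hq : refl (axis w 1 v) (1 * (star (1 - z))⁻¹.im) *ᵥ v = w := by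
    rw [refl_mulVec, hden, haxis, star_smul, smul_dotProduct, star_sub v w, sub_dotProduct,
      star_dotProduct_self, hv, ← hzdef, inv_inv, smul_smul, smul_eq_mul, star_inv₀, ofReal_one]
    rw [mul_inv_cancel_left₀ hz2, mul_inv_cancel₀ hz1, one_smul, sub_sub_cancel]
  rw [← hzdef, hq, refl_mulVec, hfw, mul_zero, zero_smul, sub_zero]

lemma smooth_rot {E : Type*} [NormedAddCommGroup E] [NormedSpace ℝ E] {w f : Fin N → ℂ}
    (hw : sqNorm w = 1) (hf : sqNorm f = 1) {s : E → ℝ} {v : E → Fin N → ℂ}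
    (hs : ContDiff ℝ ∞ s) (hv : ∀ i, ContDiff ℝ ∞ fun p => v p i)
    (h1 : ∀ p, star w ⬝ᵥ v p ≠ 1) :
    Smooth fun p => (rot hw hf (s p) (v p) : Mat N) := by
  have hf0 : f ≠ 0 := fun h => by simp [h, sqNorm] at hf
  have hz : ContDiff ℝ ∞ fun p => 1 - star w ⬝ᵥ v p := by
    simp only [dotProduct]
    exact contDiff_const.sub (ContDiff.sum fun i _ => contDiff_const.mul (hv i))
  have hz0 : ∀ p, 1 - star w ⬝ᵥ v p ≠ 0 := fun p => sub_ne_zero.2 (h1 p).symm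
  have hzw : ContDiff ℝ ∞ fun p => star w ⬝ᵥ v p := by
    simpa using (contDiff_const (c := (1 : ℂ))).sub hz
  have haxis : ∀ i, ContDiff ℝ ∞ fun p => axis w (s p) (v p) i := fun i =>
    contDiff_const.add (((ofRealCLM.contDiff.comp hs).mul (hz.inv hz0)).mul
      ((hv i).sub (hzw.mul contDiff_const)))
  have hheight : ContDiff ℝ ∞ fun p => height w (s p) (v p) :=
    hs.mul (imCLM.contDiff.comp (ContDiff.inv ((conjCLE : ℂ →L[ℝ] ℂ).contDiff.comp hz)
      fun p => star_ne_zero.2 (hz0 p)))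
  have hn : ContDiff ℝ ∞ fun p => sqNorm (axis w (s p) (v p)) := by
    simp only [sqNorm, normSq_apply]
    exact ContDiff.sum fun i _ => ((reCLM.contDiff.comp (haxis i)).mul
      (reCLM.contDiff.comp (haxis i))).add ((imCLM.contDiff.comp (haxis i)).mul
      (imCLM.contDiff.comp (haxis i)))
  have hq0 : ∀ p, axis w (s p) (v p) ≠ 0 := fun p => axis_ne_zero hw _ _
  have hdiv : ContDiff ℝ ∞ fun p => -(height w (s p) (v p) / sqNorm (axis w (s p) (v p))) :=
    (hheight.div hn fun p => (sqNorm_pos (hq0 p)).ne').neg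
  have h2 := (smooth_refl (q := fun _ => f) (fun _ => contDiff_const) hdiv fun _ => hf0)
  exact h2.mul (smooth_refl haxis hheight hq0)

end Rotations

/-! ### Loops in `SU(N)` are null-homotopic -/

section Loops

variable {N : ℕ} {L : ℝ}

/-- A loop `g : ℝ → SU(N)` of period `L` is smoothly null-homotopic, through loops of the same
period.  The homotopy is required to be stationary outside `0 ≤ s ≤ 1`, so that it can be glued
smoothly. -/
def NullHomotopic (L : ℝ) (g : ℝ → SU N) : Prop :=
  ∃ H : ℝ × ℝ → SU N, Smooth (fun p => (H p : Mat N)) ∧ (∀ x s, H (x + L, s) = H (x, s)) ∧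
    (∀ x, ∀ s ≤ 0, H (x, s) = 1) ∧ ∀ x, ∀ s ≥ 1, H (x, s) = g x

lemma nullHomotopic_one : NullHomotopic L (fun _ => (1 : SU N)) :=
  ⟨fun _ => 1, smooth_const _, fun _ _ => rfl, fun _ _ _ => rfl, fun _ _ _ => rfl⟩

lemma NullHomotopic.mul {g h : ℝ → SU N} (hg : NullHomotopic L g) (hh : NullHomotopic L h) :
    NullHomotopic L (fun x => g x * h x) := by
  obtain ⟨G, hG, hGp, hG0, hG1⟩ := hg
  obtain ⟨H, hH, hHp, hH0, hH1⟩ := hh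
  exact ⟨fun p => G p * H p, hG.coe_mul hH, fun x s => by simp only [hGp, hHp],
    fun x s hs => by simp only [hG0 x s hs, hH0 x s hs, mul_one],
    fun x s hs => by simp only [hG1 x s hs, hH1 x s hs]⟩

lemma NullHomotopic.inv {g : ℝ → SU N} (hg : NullHomotopic L g) :
    NullHomotopic L (fun x => (g x)⁻¹) := by
  obtain ⟨G, hG, hGp, hG0, hG1⟩ := hg
  exact ⟨fun p => (G p)⁻¹, hG.coe_inv, fun x s => by simp only [hGp],
    fun x s hs => by simp only [hG0 x s hs, inv_one], fun x s hs => by simp only [hG1 x s hs]⟩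

lemma NullHomotopic.smooth {g : ℝ → SU N} (hg : NullHomotopic L g) :
    Smooth fun x => (g x : Mat N) := by
  obtain ⟨G, hG, -, -, hG1⟩ := hg
  simp only [← hG1 _ 1 le_rfl]
  exact hG.comp (contDiff_id.prodMk contDiff_const)

lemma NullHomotopic.periodic {g : ℝ → SU N} (hg : NullHomotopic L g) (x : ℝ) :
    g (x + L) = g x := by
  obtain ⟨G, -, hGp, -, hG1⟩ := hg
  rw [← hG1 _ 1 le_rfl, hGp, hG1 _ 1 le_rfl]

lemma sqNorm_single_add_single {a b : Fin N} (hab : a ≠ b) (α β : ℂ) :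
    sqNorm (Pi.single a α + Pi.single b β) = normSq α + normSq β := by
  have h : (sqNorm (Pi.single a α + Pi.single b β) : ℂ) = ((normSq α + normSq β : ℝ) : ℂ) := by
    rw [← star_dotProduct_self]
    simp [dotProduct_add, hab, hab.symm, normSq_eq_conj_mul_self]
  exact_mod_cast h

/-- For dimension reasons the cone over a smooth curve in `ℂ²` does not fill `ℂ²`, so a smooth curve
misses some unit vector of `ℂ²`, which can moreover be chosen off the first coordinate axis. -/
lemma exists_unit_notMem_range {v₁ v₂ : ℝ → ℂ} (h₁ : ContDiff ℝ ∞ v₁) (h₂ : ContDiff ℝ ∞ v₂) :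
    ∃ α β : ℂ, normSq α + normSq β = 1 ∧ β ≠ 0 ∧ ∀ x, ¬(v₁ x = α ∧ v₂ x = β) := by
  let φ : ℝ × ℝ → ℂ × ℂ := fun p => (p.1 * v₁ p.2, p.1 * v₂ p.2)
  have hφ : ContDiff ℝ ∞ φ :=
    ((ofRealCLM.contDiff.comp contDiff_fst).mul (h₁.comp contDiff_snd)).prodMk
      ((ofRealCLM.contDiff.comp contDiff_fst).mul (h₂.comp contDiff_snd))
  have hdense : Dense (Set.range φ)ᶜ :=
    (hφ.of_le (by exact_mod_cast le_top)).dense_compl_range_of_finrank_lt_finrank (by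
      simp [Complex.finrank_real_complex])
  -- a point off the cone; if the curve passed through its normalization, it would lie on the cone
  obtain ⟨⟨y₁, y₂⟩, hy2, hy⟩ := hdense.inter_open_nonempty {y : ℂ × ℂ | y.2 ≠ 0}
    (isOpen_ne_fun continuous_snd continuous_const) ⟨(0, 1), by simp⟩
  simp only [Set.mem_ofPred_eq] at hy2
  have hpos : 0 < normSq y₁ + normSq y₂ :=
    add_pos_of_nonneg_of_pos (normSq_nonneg _) (normSq_pos.2 hy2)
  obtain ⟨m, hm, hm2⟩ : ∃ m : ℝ, 0 < m ∧ m * m = normSq y₁ + normSq y₂ :=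
    ⟨_, Real.sqrt_pos.2 hpos, Real.mul_self_sqrt hpos.le⟩
  have hm0 : (m : ℂ) ≠ 0 := ofReal_ne_zero.2 hm.ne'
  refine ⟨y₁ / m, y₂ / m, ?_, div_ne_zero hy2 hm0, fun x hx => hy ⟨(m, x), ?_⟩⟩
  · rw [normSq_div, normSq_div, normSq_ofReal, ← add_div, ← hm2, div_self (mul_pos hm hm).ne']
  · simp only [φ, hx.1, hx.2, mul_div_cancel₀ _ hm0]

lemma inv_mulVec_eq {U : SU N} {v w : Fin N → ℂ} (h : (U : Mat N) *ᵥ v = w) :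
    ((U⁻¹ : SU N) : Mat N) *ᵥ w = v := by
  rw [← h, Matrix.mulVec_mulVec, coe_inv_mul, Matrix.one_mulVec]

/-- A unitary matrix fixing a basis vector has the corresponding row of the identity, too. -/
lemma apply_eq_of_mulVec_single {U : SU N} {i : Fin N}
    (h : (U : Mat N) *ᵥ Pi.single i 1 = Pi.single i 1) (j : Fin N) :
    (U : Mat N) i j = (1 : Mat N) i j := by
  have h2 := congrFun (inv_mulVec_eq h) j
  rw [Matrix.mulVec_single_one, coe_inv, Matrix.col_apply, Matrix.conjTranspose_apply] at h2
  rw [← star_star ((U : Mat N) i j), h2, Matrix.one_apply, Pi.single_apply]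
  by_cases hij : i = j <;> simp [hij, eq_comm]

lemma sqNorm_col (U : SU N) (a : Fin N) : sqNorm (fun i => (U : Mat N) i a) = 1 := by
  have h : (sqNorm (fun i => (U : Mat N) i a) : ℂ) = 1 := by
    rw [← star_dotProduct_self]
    have h2 := congrFun (congrFun (coe_inv_mul U) a) a
    rw [Matrix.mul_apply, Matrix.one_apply_eq] at h2
    rw [← h2]
    rfl
  exact_mod_cast h

/-- An element of `SU(N)` fixing all basis vectors but one is the identity: its last diagonal entry
is its determinant. -/
lemma eq_one_of_mulVec_single {U : SU N} (a : Fin N)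
    (h : ∀ i, i ≠ a → (U : Mat N) *ᵥ Pi.single i 1 = Pi.single i 1) : U = 1 := by
  have hoff : ∀ i j, i ≠ a ∨ j ≠ a → (U : Mat N) i j = (1 : Mat N) i j := by
    rintro i j (hi | hj)
    · exact apply_eq_of_mulVec_single (h i hi) j
    · have h2 := congrFun (h j hj) i
      rw [Matrix.mulVec_single_one, Matrix.col_apply] at h2
      rw [h2, Matrix.one_apply, Pi.single_apply]
  have hdiag : (U : Mat N) = Matrix.diagonal (fun i => (U : Mat N) i i) := by
    ext i j
    by_cases hij : i = j
    · subst hij; simp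
    · have : i ≠ a ∨ j ≠ a := by
        by_contra hc
        push Not at hc
        exact hij (hc.1.trans hc.2.symm)
      rw [hoff i j this, Matrix.one_apply_ne hij, Matrix.diagonal_apply_ne _ hij]
  have hdet := (Matrix.mem_specialUnitaryGroup_iff.1 U.2).2
  rw [hdiag, Matrix.det_diagonal, Finset.prod_eq_single a
    (fun i _ hi => by rw [hoff i i (Or.inl hi), Matrix.one_apply_eq]) (by simp)] at hdet
  apply Subtype.ext
  ext i j
  by_cases hij : i = a ∧ j = a
  · rw [hij.1, hij.2, hdet]; simp
  · exact hoff i j (by tauto)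

/-- A curve of unit vectors missing `w` can be contracted along stereographic rays from `w`, and
this lifts to the curve in `SU(N)` moving its points to `w`. -/
lemma nullHomotopic_inv_rot_mul_rot {w f e : Fin N → ℂ} {v : ℝ → Fin N → ℂ} (hw : sqNorm w = 1)
    (hf : sqNorm f = 1) (he : sqNorm e = 1) (hew : e ≠ w) (hv : ∀ i, ContDiff ℝ ∞ fun x => v x i)
    (hv1 : ∀ x, sqNorm (v x) = 1) (hvw : ∀ x, v x ≠ w) (hvp : ∀ x, v (x + L) = v x) :
    NullHomotopic L (fun x => (rot hw hf 1 e)⁻¹ * rot hw hf 1 (v x)) := by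
  have hσ : ContDiff ℝ ∞ fun p : ℝ × ℝ => Real.smoothTransition p.2 :=
    Real.smoothTransition.contDiff.comp contDiff_snd
  have h1 : Smooth fun p : ℝ × ℝ => (rot hw hf (Real.smoothTransition p.2) e : Mat N) :=
    smooth_rot hw hf (v := fun _ => e) hσ (fun _ => contDiff_const)
      fun _ => dotProduct_ne_one he hw hew
  have hv2 : ∀ i, ContDiff ℝ ∞ fun p : ℝ × ℝ => v p.1 i := fun i => (hv i).comp contDiff_fst
  have h2 : Smooth fun p : ℝ × ℝ => (rot hw hf (Real.smoothTransition p.2) (v p.1) : Mat N) :=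
    smooth_rot hw hf (v := fun p : ℝ × ℝ => v p.1) hσ hv2
      fun p => dotProduct_ne_one (hv1 p.1) hw (hvw p.1)
  refine ⟨fun p => (rot hw hf (Real.smoothTransition p.2) e)⁻¹ *
    rot hw hf (Real.smoothTransition p.2) (v p.1), h1.coe_inv.coe_mul h2,
    fun x s => by simp only [hvp], fun x s hs => ?_, fun x s hs => ?_⟩
  · simp only [Real.smoothTransition.zero_of_nonpos hs]
    rw [rot_zero hw hf (v x) e, inv_mul_cancel]
  · simp only [Real.smoothTransition.one_of_one_le hs]

/-- One step of the reduction: a loop fixing `e_i` for `i ∈ S` is the product of a null-homotopic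
loop with one fixing in addition `e_a`, provided that at least one more basis vector `e_b` is
available, which makes room for a unit vector missed by the curve `g e_a`. -/
lemma exists_nullHomotopic_mul_fixes {g : ℝ → SU N} (hg : Smooth fun x => (g x : Mat N))
    (hp : ∀ x, g (x + L) = g x) {S : Finset (Fin N)} {a b : Fin N} (ha : a ∉ S) (hb : b ∉ S)
    (hab : a ≠ b) (hS : ∀ i ∈ S, ∀ x, (g x : Mat N) *ᵥ Pi.single i 1 = Pi.single i 1) :
    ∃ k : ℝ → SU N, NullHomotopic L k ∧
      ∀ i ∈ insert a S, ∀ x, ((k x * g x : SU N) : Mat N) *ᵥ Pi.single i 1 = Pi.single i 1 := by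
  obtain ⟨α, β, hαβ, hβ, hmiss⟩ := exists_unit_notMem_range (hg a a) (hg b a)
  let w : Fin N → ℂ := Pi.single a α + Pi.single b β
  let f : Fin N → ℂ := Pi.single a (-star β) + Pi.single b (star α)
  have hw : sqNorm w = 1 := by rw [sqNorm_single_add_single hab, hαβ]
  have hf : sqNorm f = 1 := by
    rw [sqNorm_single_add_single hab, normSq_neg, add_comm]
    simpa [normSq_conj] using hαβ
  have hfw : star f ⬝ᵥ w = 0 := by
    simp [f, w, dotProduct_add, hab, hab.symm]
    ring
  have hwS : ∀ i ∈ S, w i = 0 := fun i hi => by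
    simp [w, ne_of_mem_of_not_mem hi ha, ne_of_mem_of_not_mem hi hb]
  have hfS : ∀ i ∈ S, f i = 0 := fun i hi => by
    simp [f, ne_of_mem_of_not_mem hi ha, ne_of_mem_of_not_mem hi hb]
  let v : ℝ → Fin N → ℂ := fun x i => (g x : Mat N) i a
  have hv1 : ∀ x, sqNorm (v x) = 1 := fun x => sqNorm_col _ _
  have hvw : ∀ x, v x ≠ w := fun x h => hmiss x
    ⟨by simpa [v, w, hab] using congrFun h a, by simpa [v, w, hab.symm] using congrFun h b⟩
  have hvS : ∀ i ∈ S, ∀ x, v x i = 0 := fun i hi x => by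
    simp only [v]
    rw [apply_eq_of_mulVec_single (hS i hi x), Matrix.one_apply_ne (ne_of_mem_of_not_mem hi ha)]
  let e : Fin N → ℂ := Pi.single a 1
  have he1 : sqNorm e = 1 := by
    have := sqNorm_single_add_single hab 1 0
    simpa [e] using this
  have hew : e ≠ w := fun h => hβ (by simpa [e, w, hab.symm] using (congrFun h b).symm)
  have heS : ∀ i ∈ S, e i = 0 := fun i hi => by
    simp [e, ne_of_mem_of_not_mem hi ha]
  have hvp : ∀ x, v (x + L) = v x := fun x => by simp only [v, hp]
  refine ⟨fun x => (rot hw hf 1 e)⁻¹ * rot hw hf 1 (v x),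
    nullHomotopic_inv_rot_mul_rot hw hf he1 hew (fun i => hg i a) hv1 hvw hvp, fun i hi x => ?_⟩
  simp only [Submonoid.coe_mul, ← Matrix.mulVec_mulVec]
  rcases Finset.mem_insert.1 hi with rfl | hi
  · have hcol : (g x : Mat N) *ᵥ Pi.single i 1 = v x := by
      rw [Matrix.mulVec_single_one]; rfl
    rw [hcol, rot_one_mulVec hw hf hfw (hv1 x) (hvw x)]
    exact inv_mulVec_eq (rot_one_mulVec hw hf hfw he1 hew)
  · rw [hS i hi, rot_mulVec_single hw hf 1 (hwS i hi) (hfS i hi) (hvS i hi x)]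
    exact inv_mulVec_eq (rot_mulVec_single hw hf 1 (hwS i hi) (hfS i hi) (heS i hi))

/-- `SU(N)` is simply connected, in the smooth category and for free loops. -/
theorem nullHomotopic_of_periodic (hN : N ≠ 0) {g : ℝ → SU N}
    (hg : Smooth fun x => (g x : Mat N)) (hp : ∀ x, g (x + L) = g x) : NullHomotopic L g := by
  suffices h : ∀ (n : ℕ) (S : Finset (Fin N)) (g : ℝ → SU N), Sᶜ.card ≤ n + 1 →
      Smooth (fun x => (g x : Mat N)) → (∀ x, g (x + L) = g x) →
      (∀ i ∈ S, ∀ x, (g x : Mat N) *ᵥ Pi.single i 1 = Pi.single i 1) → NullHomotopic L g from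
    h (Finset.card (∅ᶜ : Finset (Fin N))) ∅ g (Nat.le_succ _) hg hp (by simp)
  have : NeZero N := ⟨hN⟩
  intro n
  induction n with
  | zero =>
    intro S g hcard _ _ hS
    obtain ⟨a, ha⟩ := Finset.card_le_one_iff_subset_singleton.1 hcard
    have hone : g = fun _ => 1 := funext fun x => eq_one_of_mulVec_single a fun i hi =>
      hS i (by
        by_contra hc
        exact hi (Finset.mem_singleton.1 (ha (Finset.mem_compl.2 hc)))) x
    rw [hone]
    exact nullHomotopic_one
  | succ n ih =>
    intro S g hcard hg hp hS
    by_cases hle : Sᶜ.card ≤ n + 1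
    · exact ih S g hle hg hp hS
    obtain ⟨a, ha, b, hb, hab⟩ := Finset.one_lt_card.1 (show 1 < Sᶜ.card by omega)
    obtain ⟨k, hk, hfix⟩ := exists_nullHomotopic_mul_fixes hg hp
      (Finset.mem_compl.1 ha) (Finset.mem_compl.1 hb) hab hS
    have hcard2 : (insert a S)ᶜ.card ≤ n + 1 := by
      rw [Finset.compl_insert, Finset.card_erase_of_mem ha]
      omega
    have hkg := ih (insert a S) (fun x => k x * g x) hcard2 (hk.smooth.mul hg)
      (fun x => by rw [hk.periodic, hp]) hfix
    simpa using hk.inv.mul hkg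

end Loops

/-! ### Clock and shift matrices -/

section TwistEaters

variable {N : ℕ}

/-- The phases `exp (2πi k (i - (N - 1)/2) x / (N L))`.  At `x = L` they are the diagonal entries of
the `k`-th power of the clock matrix up to a common phase; the shift by `(N - 1)/2` makes their
product equal to `1`. -/
noncomputable def clockPhase (N : ℕ) (L : ℝ) (k : ℤ) (x : ℝ) (i : Fin N) : ℂ :=
  exp (((2 * Real.pi * k * (i - (N - 1) / 2) / (N * L) * x : ℝ) : ℂ) * I)

lemma star_clockPhase_mul_self (L : ℝ) (k : ℤ) (x : ℝ) (i : Fin N) :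
    star (clockPhase N L k x i) * clockPhase N L k x i = 1 := by
  rw [clockPhase, Complex.star_def, ← normSq_eq_conj_mul_self, normSq_eq_norm_sq,
    norm_exp_ofReal_mul_I]
  simp

lemma sum_range_cast (n : ℕ) : ∑ i ∈ Finset.range n, (i : ℝ) = n * (n - 1) / 2 := by
  induction n with
  | zero => simp
  | succ n ih => rw [Finset.sum_range_succ, ih]; push_cast; ring

lemma prod_clockPhase (L : ℝ) (k : ℤ) (x : ℝ) : ∏ i, clockPhase N L k x i = 1 := by
  have hsum : ∑ i : Fin N, (2 * Real.pi * k * ((i : ℕ) - (N - 1) / 2) / (N * L) * x : ℝ) = 0 := by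
    rw [← Finset.sum_mul, ← Finset.sum_div, ← Finset.mul_sum, Finset.sum_sub_distrib,
      Fin.sum_univ_eq_sum_range (fun i => (i : ℝ)), sum_range_cast]
    simp only [Finset.sum_const, Finset.card_univ, Fintype.card_fin, nsmul_eq_mul]
    ring
  simp only [clockPhase]
  rw [← Complex.exp_sum, ← Finset.sum_mul, ← ofReal_sum, hsum]
  simp

/-- The one-parameter group of diagonal matrices in `SU(N)` with entries `clockPhase`. -/
noncomputable def clockPath (N : ℕ) (L : ℝ) (k : ℤ) (x : ℝ) : SU N :=
  ⟨Matrix.diagonal (clockPhase N L k x), by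
    refine Matrix.mem_specialUnitaryGroup_iff.2 ⟨?_, ?_⟩
    · rw [Matrix.mem_unitaryGroup_iff', Matrix.star_eq_conjTranspose, Matrix.diagonal_conjTranspose,
        Matrix.diagonal_mul_diagonal, ← Matrix.diagonal_one]
      exact congrArg _ (funext fun i => star_clockPhase_mul_self L k x i)
    · rw [Matrix.det_diagonal, prod_clockPhase]⟩

lemma smooth_clockPath (L : ℝ) (k : ℤ) : Smooth fun x => (clockPath N L k x : Mat N) := by
  intro i j
  simp only [clockPath, Matrix.diagonal_apply]
  split_ifs
  · exact ((ofRealCLM.contDiff.comp (contDiff_const.mul contDiff_id)).mul contDiff_const).cexp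
  · exact contDiff_const

lemma clockPath_add (L : ℝ) (k : ℤ) (x y : ℝ) :
    clockPath N L k (x + y) = clockPath N L k y * clockPath N L k x := by
  apply Subtype.ext
  simp only [clockPath, Submonoid.coe_mul, Matrix.diagonal_mul_diagonal]
  refine congrArg _ (funext fun i => ?_)
  simp only [clockPhase]
  rw [← Complex.exp_add]
  congr 1
  push_cast
  ring

/-- The shift matrix, scaled by a phase to have determinant `1`, commutes with the clock matrix up
to `ω_N^k`. -/
lemma exists_shift (hN : N ≠ 0) {L : ℝ} (hL : L ≠ 0) (k : ℤ) :
    ∃ b : SU N, (((clockPath N L k L)⁻¹ * b * clockPath N L k L : SU N) : Mat N) =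
      (omega N) ^ k • (b : Mat N) := by
  have : NeZero N := ⟨hN⟩
  have hN' : (N : ℂ) ≠ 0 := Nat.cast_ne_zero.2 hN
  let σ : Equiv.Perm (Fin N) := Equiv.addRight 1
  obtain ⟨ζ, hζ⟩ := IsAlgClosed.exists_pow_nat_eq (((Equiv.Perm.sign σ : ℤ)) : ℂ)
    (Nat.pos_of_ne_zero hN)
  have hsign : (((Equiv.Perm.sign σ : ℤ)) : ℂ) * (((Equiv.Perm.sign σ : ℤ)) : ℂ) = 1 := by
    rw [← Int.cast_mul, ← Units.val_mul, Int.units_mul_self]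
    simp
  have hζ1 : star ζ * ζ = 1 := by
    have h1 : ‖ζ‖ ^ N = 1 := by
      rw [← norm_pow, hζ]
      rcases Int.units_eq_one_or (Equiv.Perm.sign σ) with h | h <;> simp [h]
    have h2 : ‖ζ‖ = 1 := (pow_eq_one_iff_of_nonneg (norm_nonneg _) hN).1 h1
    rw [Complex.star_def, ← normSq_eq_conj_mul_self, normSq_eq_norm_sq, h2]
    simp
  refine ⟨⟨ζ • σ.permMatrix ℂ, Matrix.mem_specialUnitaryGroup_iff.2 ⟨?_, ?_⟩⟩, ?_⟩
  · rw [Matrix.mem_unitaryGroup_iff', Matrix.star_eq_conjTranspose, Matrix.conjTranspose_smul,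
      Matrix.conjTranspose_permMatrix, smul_mul_smul_comm, hζ1, one_smul, ← Matrix.permMatrix_mul,
      mul_inv_cancel, Matrix.permMatrix_one]
  · rw [Matrix.det_smul, Matrix.det_permutation, Fintype.card_fin, hζ, hsign]
  · rw [Submonoid.coe_mul, Submonoid.coe_mul, coe_inv]
    simp only [clockPath]
    ext i j
    rw [Matrix.diagonal_conjTranspose, Matrix.mul_diagonal, Matrix.diagonal_mul]
    simp only [Matrix.smul_apply, smul_eq_mul, Equiv.Perm.permMatrix, PEquiv.toMatrix_apply,
      Equiv.toPEquiv_apply, Option.mem_some_iff, Pi.star_apply]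
    by_cases hij : σ i = j
    · -- the exponents of neighbouring entries differ by `k / N`, up to an integer from the wrap
      have hstep : clockPhase N L k L j = omega N ^ k * clockPhase N L k L i := by
        obtain ⟨q, hq⟩ : ∃ q : ℤ, ((j : ℕ) : ℂ) = (i : ℕ) + 1 - N * q := by
          have hmod : (j : ℕ) = ((i : ℕ) + 1) % N := by
            rw [← hij]
            simp [σ, Fin.val_add, Nat.add_mod]
          refine ⟨(((i : ℕ) + 1) / N : ℕ), ?_⟩
          have hdiv := Nat.mod_add_div ((i : ℕ) + 1) N
          rw [← hmod] at hdiv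
          rw [eq_sub_iff_add_eq]
          exact_mod_cast hdiv
        simp only [clockPhase, omega]
        rw [← Complex.exp_int_mul, ← Complex.exp_add, Complex.exp_eq_exp_iff_exists_int]
        refine ⟨-(k * q), ?_⟩
        have hL' : (L : ℂ) ≠ 0 := ofReal_ne_zero.2 hL
        push_cast
        rw [hq]
        field_simp
        ring
      rw [if_pos hij, hstep]
      linear_combination (ζ * omega N ^ k) * star_clockPhase_mul_self L k L i
    · rw [if_neg hij]; simp

end TwistEaters

/-! ### The gauge function -/

section Gluing

variable {N : ℕ} {L β : ℝ}

/-- A null-homotopy of the loop `T Ω⁻¹`, used as transition from `1` to `T Ω⁻¹` on a strip of width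
`β`, extends to the plane quasi-periodically. -/
lemma exists_quasiPeriodic (hβ : 0 < β) {T Ω : ℝ → SU N} {c : SU N} (hc : ∀ V : SU N, Commute c V)
    (hT : Smooth fun x => (T x : Mat N)) (hΩ : Smooth fun x => (Ω x : Mat N))
    (hTp : ∀ x, T (x + L) = c * T x) (hΩp : ∀ x, Ω (x + L) = c * Ω x)
    (hH : NullHomotopic L (fun x => T x * (Ω x)⁻¹)) :
    ∃ W : ℝ × ℝ → SU N, Smooth (fun p => (W p : Mat N)) ∧ (∀ x t, W (x + L, t) = W (x, t)) ∧
      ∀ x t, W (x, t + β) = T x * W (x, t) * (Ω x)⁻¹ := by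
  obtain ⟨H, hHs, hHp, hH0, hH1⟩ := hH
  let V : ℤ → ℝ × ℝ → SU N := fun n p =>
    T p.1 ^ n * H (p.1, 3 * (p.2 / β - n) - 1) * (Ω p.1 ^ n)⁻¹
  have hV : ∀ n, Smooth fun p => (V n p : Mat N) := fun n => by
    have h1 : Smooth fun p : ℝ × ℝ => (H (p.1, 3 * (p.2 / β - n) - 1) : Mat N) := hHs.comp
      (contDiff_fst.prodMk ((contDiff_const.mul ((contDiff_snd.div_const β).sub
        contDiff_const)).sub contDiff_const))
    exact (((hT.coe_zpow n).comp contDiff_fst).mul h1).mul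
      (((hΩ.coe_zpow n).coe_inv).comp contDiff_fst)
  -- near the line `t = n β` both neighbouring formulas give `T ^ n * Ω ^ (-n)`
  have hoverlap : ∀ (n : ℤ) (p : ℝ × ℝ), n - 1 / 3 < p.2 / β → p.2 / β < n →
      V (n - 1) p = V n p := fun n p h1 h2 => by
    simp only [V]
    rw [hH1 _ _ (by push_cast; linarith), hH0 _ _ (by linarith), zpow_sub_one, zpow_sub_one]
    group
  -- the homotopy is stationary outside `1/3 ≤ t/β - n ≤ 2/3`, which leaves room for the overlap
  refine ⟨fun p => V ⌊p.2 / β⌋ p, fun i j => ?_, fun x t => ?_, fun x t => ?_⟩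
  · rw [contDiff_iff_contDiffAt]
    intro p₀
    refine ((hV ⌊p₀.2 / β⌋) i j).contDiffAt.congr_of_eventuallyEq ?_
    have hopen : ∀ᶠ p : ℝ × ℝ in nhds p₀, (⌊p₀.2 / β⌋ : ℝ) - 1 / 3 < p.2 / β ∧
        p.2 / β < ⌊p₀.2 / β⌋ + 1 := by
      have hcont : Continuous fun p : ℝ × ℝ => p.2 / β := continuous_snd.div_const β
      refine (hcont.continuousAt.eventually (lt_mem_nhds ?_)).and
        (hcont.continuousAt.eventually (gt_mem_nhds (Int.lt_floor_add_one _)))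
      linarith [Int.floor_le (p₀.2 / β)]
    filter_upwards [hopen] with p hp
    rcases lt_or_ge (p.2 / β) ⌊p₀.2 / β⌋ with hlt | hge
    · have hfloor : ⌊p.2 / β⌋ = ⌊p₀.2 / β⌋ - 1 := by
        rw [Int.floor_eq_iff]
        push_cast
        constructor <;> linarith [hp.1]
      rw [hfloor, hoverlap _ _ hp.1 hlt]
    · rw [Int.floor_eq_iff.2 ⟨hge, hp.2⟩]
  · simp only [V]
    rw [hTp, hΩp, hHp, (hc _).mul_zpow, (hc _).mul_zpow, mul_inv_rev, mul_assoc (c ^ _),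
      mul_assoc (c ^ _), ((hc _).zpow_left _).eq, ← mul_assoc, mul_assoc _ _ (c ^ _),
      inv_mul_cancel, mul_one]
  · simp only [V]
    have hadd : (t + β) / β = t / β + 1 := by rw [add_div, div_self hβ.ne']
    have harg : 3 * (t / β + 1 - ((⌊t / β⌋ + 1 : ℤ) : ℝ)) - 1 = 3 * (t / β - ⌊t / β⌋) - 1 := by
      push_cast; ring
    rw [hadd, Int.floor_add_one, harg, zpow_add_one, zpow_add_one, ← (Commute.self_zpow (T x) _).eq]
    group

/-- For any twist there is a gauge function whose pure gauge satisfies the boundary conditions. -/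
lemma exists_gaugeFunction (hN : N ≠ 0) (hL : 0 < L) (hβ : 0 < β) {k : ℤ} {Ω : ℝ → SU N}
    (hΩ : IsTwist L k Ω) :
    ∃ (U : ℝ × ℝ → SU N) (a b : SU N), Smooth (fun p => (U p : Mat N)) ∧
      (∀ x t, U (x + L, t) = a * U (x, t)) ∧
      ∀ x t, U (x, t + β) = b * U (x, t) * (Ω x)⁻¹ := by
  obtain ⟨hΩs, hΩ0, hΩp⟩ := hΩ
  have hscalar : (Ω L : Mat N) = (omega N) ^ k • (1 : Mat N) := by
    have h := hΩp 0
    rwa [zero_add, hΩ0] at h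
  have hmul : ∀ V : SU N, ((Ω L * V : SU N) : Mat N) = (omega N) ^ k • (V : Mat N) := fun V => by
    rw [Submonoid.coe_mul, hscalar, Matrix.smul_mul, Matrix.one_mul]
  have hcomm : ∀ V : SU N, Commute (Ω L) V := fun V => by
    apply Subtype.ext
    rw [hmul, Submonoid.coe_mul, hscalar, Matrix.mul_smul, Matrix.mul_one]
  have hΩp' : ∀ x, Ω (x + L) = Ω L * Ω x := fun x => Subtype.ext (by rw [hmul, hΩp])
  obtain ⟨b, hb⟩ := exists_shift hN hL.ne' k
  have hb' : (clockPath N L k L)⁻¹ * b * clockPath N L k L = Ω L * b :=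
    Subtype.ext (by rw [hb, hmul])
  have hα := smooth_clockPath (N := N) L k
  let T : ℝ → SU N := fun x => (clockPath N L k x)⁻¹ * b * clockPath N L k x
  have hT : Smooth fun x => (T x : Mat N) :=
    (hα.coe_inv.coe_mul (smooth_const (b : Mat N))).coe_mul hα
  have hTp : ∀ x, T (x + L) = Ω L * T x := fun x => by
    simp only [T]
    rw [clockPath_add, mul_inv_rev]
    calc (clockPath N L k x)⁻¹ * (clockPath N L k L)⁻¹ * b *
          (clockPath N L k L * clockPath N L k x)
        = (clockPath N L k x)⁻¹ * ((clockPath N L k L)⁻¹ * b * clockPath N L k L) *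
          clockPath N L k x := by group
      _ = Ω L * ((clockPath N L k x)⁻¹ * b * clockPath N L k x) := by
        rw [hb', ← mul_assoc, ← (hcomm _).eq]
        group
  have hg : NullHomotopic L (fun x => T x * (Ω x)⁻¹) :=
    nullHomotopic_of_periodic hN (hT.coe_mul hΩs.coe_inv) fun x => by
      rw [hTp, hΩp', (hcomm (T x)).eq, (hcomm (Ω x)).eq]
      group
  obtain ⟨W, hW, hWL, hWβ⟩ := exists_quasiPeriodic hβ hcomm hT hΩs hTp hΩp' hg
  refine ⟨fun p => clockPath N L k p.1 * W p, clockPath N L k L, b,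
    Smooth.coe_mul (hα.comp contDiff_fst) hW, fun x t => ?_, fun x t => ?_⟩
  · simp only [hWL, clockPath_add, mul_assoc]
  · simp only [hWβ, T]
    group

end Gluing

end TorusGauge

theorem theorem1 (N : ℕ) (hN : 2 ≤ N) (L β : ℝ) (hL : 0 < L) (hβ : 0 < β) (k : ℤ)
    (Ω : ℝ → TorusGauge.SU N) (hΩ : TorusGauge.IsTwist L k Ω)
    (A : TorusGauge.Potential N) (hA : TorusGauge.IsGaugeField A)
    (hbc : TorusGauge.TwistedBC L β Ω A) :
    ∃ (A' : TorusGauge.Potential N) (𝒜 : ℝ → TorusGauge.Potential N),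
      TorusGauge.IsSmoothDeformation L β Ω A A' 𝒜 ∧
      TorusGauge.IsPureGauge A' ∧
      ∀ μ ν p, TorusGauge.fieldStrength A' μ ν p = 0 := by
  obtain ⟨U, a, b, hU, hx, ht⟩ := TorusGauge.exists_gaugeFunction (by omega : N ≠ 0) hL hβ hΩ
  obtain ⟨𝒜, h𝒜⟩ := TorusGauge.exists_isSmoothDeformation hA (TorusGauge.isGaugeField_pureGauge hU)
    hbc (TorusGauge.twistedBC_pureGauge hΩ.1 hU a b hx ht)
  exact ⟨TorusGauge.pureGauge U, 𝒜, h𝒜, TorusGauge.isPureGauge_pureGauge hU,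
    TorusGauge.fieldStrength_pureGauge hU⟩
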